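/- Let $\mathcal H$ be a separable (real or complex) Hilbert space and $I$ a countable index set. For a closed subspace $U$ let $\pi_U$ be the orthogonal projection onto $U$. A family $W=\{(W_i,\omega_i)\}_{i\in I}$ of closed subspaces with weights $\omega_i>0$ is a *fusion frame* with bounds $0<C\le D<\infty$ if $C\|f\|^2\le\sum_{i}\omega_i^2\|\pi_{W_i}f\|^2\le D\|f\|^2$ for all $f\in\mathcal H$, and a *Bessel fusion sequence* if the upper inequality holds for some $D<\infty$. For a fusion frame $W$ put $S_Wf=\sum_i\omega_i^2\pi_{W_i}f$, a bounded invertible operator. A family $\{W_i\}_{i\in I}$ of closed subspaces is a *fusion Riesz basis* if $\overline{\operatorname{span}}\{W_i\}_{i\in I}=\mathcal H$ and there are constants $C,D>0$ with $C\sum_{i\in J}\|f_i\|^2\le\|\sum_{i\in J}f_i\|^2\le D\sum_{i\in J}\|f_i\|^2$ for all finite $J\subset I$ and all $f_i\in W_i$. A Bessel fusion sequence $V=\{(V_i,\omega_i)\}_{i\in I}$ is an *approximate dual* of a fusion frame $W=\{(W_i,\omega_i)\}_{i\in I}$ if $\|I_{\mathcal H}-\psi_{vw}\|<1$ (operator norm),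 where $\psi_{vw}f=\sum_i\omega_i^2\pi_{V_i}S_W^{-1}\pi_{W_i}f$. Two fusion frames $\{(W_i,\omega_i)\}_{i\in I}$ and $\{(U_i,\omega_i)\}_{i\in I}$ are *woven* if there are constants $0<C\le D<\infty$ such that for every $\sigma\subset I$ the family $\{(W_i,\omega_i)\}_{i\in\sigma}\cup\{(U_i,\omega_i)\}_{i\in\sigma^c}$ is a fusion frame for $\mathcal H$ with bounds $C$ and $D$. **Statement.** Let $W=\{(W_i,\omega_i)\}_{i\in I}$ be a fusion frame for $\mathcal H$ such that $\{W_i\}_{i\in I}$ is a fusion Riesz basis, and let $V=\{(V_i,\omega_i)\}_{i\in I}$ be an approximate dual of $W$. Then $\psi_{vw}$ is invertible, and $W$ and $\{(\psi_{vw}^{-1}V_i,\omega_i)\}_{i\in I}$ are woven fusion frames. -/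

import Mathlib

open scoped InnerProductSpace

noncomputable section

namespace FusionFrames

variable {𝕜 : Type*} [RCLike 𝕜] {H : Type*} [NormedAddCommGroup H] [InnerProductSpace 𝕜 H]
  [CompleteSpace H] {I : Type*}

/-- The orthogonal projection of `H` onto a closed subspace `U`. (It is defined for an arbitrary
subspace as the projection onto the closure, and only used for closed ones, where the closure is
`U` itself: see `orthProj_eq_starProjection`.) -/
def orthProj (U : Submodule 𝕜 H) : H →L[𝕜] H := U.topologicalClosure.starProjection

theorem orthProj_eq_starProjection (U : Submodule 𝕜 H) [U.HasOrthogonalProjection]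
    (hU : IsClosed (U : Set H)) : orthProj U = U.starProjection := by
  have h : U.topologicalClosure = U := hU.submodule_topologicalClosure_eq
  unfold orthProj
  congr 1

/-- `W = {(W_i, ω_i)}` is a weighted family: closed subspaces with positive weights. -/
structure IsWeightedFamily (W : I → Submodule 𝕜 H) (ω : I → ℝ) : Prop where
  isClosed : ∀ i, IsClosed (W i : Set H)
  pos : ∀ i, 0 < ω i

/-- `∑ ω_i² ‖π_{W_i} f‖² ≤ D ‖f‖²` for all `f` (the series being convergent). -/
def HasUpperBound (W : I → Submodule 𝕜 H) (ω : I → ℝ) (D : ℝ) : Prop :=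
  ∀ f : H, Summable (fun i => ω i ^ 2 * ‖orthProj (W i) f‖ ^ 2) ∧
    ∑' i, ω i ^ 2 * ‖orthProj (W i) f‖ ^ 2 ≤ D * ‖f‖ ^ 2

/-- `C ‖f‖² ≤ ∑ ω_i² ‖π_{W_i} f‖²` for all `f`; only used together with `HasUpperBound`, so that
the series converges. -/
def HasLowerBound (W : I → Submodule 𝕜 H) (ω : I → ℝ) (C : ℝ) : Prop :=
  ∀ f : H, C * ‖f‖ ^ 2 ≤ ∑' i, ω i ^ 2 * ‖orthProj (W i) f‖ ^ 2

/-- A Bessel fusion sequence. -/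
def IsBesselFusionSequence (W : I → Submodule 𝕜 H) (ω : I → ℝ) : Prop :=
  IsWeightedFamily W ω ∧ ∃ D : ℝ, 0 < D ∧ HasUpperBound W ω D

/-- A fusion frame for `H` with fusion frame bounds `C` and `D`. -/
def IsFusionFrameWith (W : I → Submodule 𝕜 H) (ω : I → ℝ) (C D : ℝ) : Prop :=
  IsWeightedFamily W ω ∧ 0 < C ∧ C ≤ D ∧ HasLowerBound W ω C ∧ HasUpperBound W ω D

/-- A fusion frame for `H`. -/
def IsFusionFrame (W : I → Submodule 𝕜 H) (ω : I → ℝ) : Prop :=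
  ∃ C D : ℝ, IsFusionFrameWith W ω C D

/-- A fusion Riesz sequence: closed subspaces with `C ∑ ‖f_i‖² ≤ ‖∑ f_i‖² ≤ D ∑ ‖f_i‖²` for all
finite sums of vectors `f_i ∈ W_i`. -/
def IsFusionRieszSequence (W : I → Submodule 𝕜 H) : Prop :=
  (∀ i, IsClosed (W i : Set H)) ∧
  ∃ C D : ℝ, 0 < C ∧ 0 < D ∧ ∀ (J : Finset I) (f : I → H), (∀ i ∈ J, f i ∈ W i) →
    C * ∑ i ∈ J, ‖f i‖ ^ 2 ≤ ‖∑ i ∈ J, f i‖ ^ 2 ∧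
    ‖∑ i ∈ J, f i‖ ^ 2 ≤ D * ∑ i ∈ J, ‖f i‖ ^ 2

/-- A fusion Riesz basis: a fusion Riesz sequence that is complete, i.e. whose subspaces have
dense linear span. -/
def IsFusionRieszBasis (W : I → Submodule 𝕜 H) : Prop :=
  IsFusionRieszSequence W ∧ (⨆ i, W i).topologicalClosure = ⊤

/-- A finite family of fusion frames `{(W_{ji}, ω_{ji})}`, `j < M`, is woven if there are universal
bounds `C` and `D` for all weavings. A partition `{σ_j}` of `I` into `M` (possibly empty) parts is
given by the function `p : I → Fin M` with `σ_j = {i | p i = j}`; the corresponding weaving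
`⋃_j {(W_{ji}, ω_{ji}) | i ∈ σ_j}` is then `{(W_{p(i) i}, ω_{p(i) i})}`. -/
def IsWoven {M : ℕ} (W : Fin M → I → Submodule 𝕜 H) (ω : Fin M → I → ℝ) : Prop :=
  (∀ j, IsFusionFrame (W j) (ω j)) ∧
  ∃ C D : ℝ, ∀ p : I → Fin M, IsFusionFrameWith (fun i => W (p i) i) (fun i => ω (p i) i) C D

open scoped Classical in
/-- The bounded operator `f ↦ ∑ A_i f` (unconditional convergence in norm for every `f`), if it
exists; otherwise `0`. -/
def strongSum (A : I → H →L[𝕜] H) : H →L[𝕜] H :=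
  if h : ∃ T : H →L[𝕜] H, ∀ f, HasSum (fun i => A i f) (T f) then h.choose else 0

/-- The fusion frame operator `S_W f = ∑ ω_i² π_{W_i} f`. -/
def frameOp (W : I → Submodule 𝕜 H) (ω : I → ℝ) : H →L[𝕜] H :=
  strongSum fun i => ((ω i ^ 2 : ℝ) : 𝕜) • orthProj (W i)

/-- The operator `ψ_{vw} f = ∑ ω_i ν_i π_{V_i} S_W⁻¹ π_{W_i} f`. -/
def psi (V : I → Submodule 𝕜 H) (ν : I → ℝ) (W : I → Submodule 𝕜 H) (ω : I → ℝ) : H →L[𝕜] H :=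
  strongSum fun i =>
    ((ω i * ν i : ℝ) : 𝕜) • (orthProj (V i) ∘L (frameOp W ω).inverse ∘L orthProj (W i))

/-- `{(V_i, ν_i)}` is an approximate dual of the fusion frame `{(W_i, ω_i)}`: `V` is a Bessel
fusion sequence and `‖I_H - ψ_{vw}‖ < 1` in the operator norm. -/
def IsApproximateDual (V : I → Submodule 𝕜 H) (ν : I → ℝ) (W : I → Submodule 𝕜 H) (ω : I → ℝ) :
    Prop :=
  IsFusionFrame W ω ∧ IsBesselFusionSequence V ν ∧
    ‖ContinuousLinearMap.id 𝕜 H - psi V ν W ω‖ < 1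

/-- The family of images `{T U_i}` of subspaces under a bounded operator. -/
def mapFamily (T : H →L[𝕜] H) (U : I → Submodule 𝕜 H) : I → Submodule 𝕜 H :=
  fun i => (U i).map (T : H →ₗ[𝕜] H)

/-! The series above converge, and `S_W` is invertible, so no default value is ever used. -/

theorem IsFusionFrame.isBessel {W : I → Submodule 𝕜 H} {ω : I → ℝ} (h : IsFusionFrame W ω) :
    IsBesselFusionSequence W ω := by
  obtain ⟨C, D, h1, h2, h3, -, h5⟩ := h
  exact ⟨h1, D, h2.trans_le h3, h5⟩

theorem inner_orthProj (U : Submodule 𝕜 H) (x y : H) :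
    ⟪orthProj U x, y⟫_𝕜 = ⟪x, orthProj U y⟫_𝕜 :=
  Submodule.inner_starProjection_left_eq_right _ x y

theorem orthProj_idem (U : Submodule 𝕜 H) (x : H) : orthProj U (orthProj U x) = orthProj U x :=
  Submodule.starProjection_eq_self_iff.2 (Submodule.starProjection_apply_mem _ x)

theorem norm_finsum_sq_le {V : I → Submodule 𝕜 H} {ν : I → ℝ} {D : ℝ}
    (hD : HasUpperBound V ν D) (F : Finset I) (x : I → H) :
    ‖∑ i ∈ F, (ν i : 𝕜) • orthProj (V i) (x i)‖ ^ 2 ≤ D * ∑ i ∈ F, ‖x i‖ ^ 2 := by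
  set y := ∑ i ∈ F, (ν i : 𝕜) • orthProj (V i) (x i) with hy
  have h1 : ‖y‖ ^ 2 ≤ ∑ i ∈ F, ‖x i‖ * (|ν i| * ‖orthProj (V i) y‖) := by
    have h2 : ‖y‖ ^ 2 = ‖⟪y, y⟫_𝕜‖ := by
      rw [inner_self_eq_norm_sq_to_K]; simp
    rw [h2]
    nth_rw 1 [hy]
    rw [sum_inner]
    refine (norm_sum_le _ _).trans (Finset.sum_le_sum fun i _ => ?_)
    rw [inner_smul_left, inner_orthProj, norm_mul]
    simp only [RCLike.conj_ofReal, RCLike.norm_ofReal]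
    calc _ ≤ |ν i| * (‖x i‖ * ‖orthProj (V i) y‖) := by
          gcongr; exact norm_inner_le_norm _ _
      _ = _ := by ring
  have h3 : (∑ i ∈ F, ‖x i‖ * (|ν i| * ‖orthProj (V i) y‖)) ^ 2
      ≤ (∑ i ∈ F, ‖x i‖ ^ 2) * (D * ‖y‖ ^ 2) := by
    refine (Finset.sum_mul_sq_le_sq_mul_sq _ _ _).trans ?_
    refine mul_le_mul_of_nonneg_left ?_ (Finset.sum_nonneg fun i _ => by positivity)
    refine le_trans ?_ (hD y).2
    simp only [mul_pow, sq_abs]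
    exact (hD y).1.sum_le_tsum F fun i _ => by positivity
  by_cases h0 : ‖y‖ = 0
  · have hn : 0 ≤ D * ∑ i ∈ F, ‖x i‖ ^ 2 := by
      by_cases hx : ∀ i ∈ F, ‖x i‖ ^ 2 = 0
      · rw [Finset.sum_eq_zero hx]; simp
      · push Not at hx
        obtain ⟨i, -, hi⟩ := hx
        have h4 : 0 ≤ D * ‖x i‖ ^ 2 :=
          (tsum_nonneg fun j => by positivity).trans (hD (x i)).2
        have h5 : 0 < ‖x i‖ ^ 2 := lt_of_le_of_ne (by positivity) (Ne.symm hi)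
        have h6 : 0 ≤ D := nonneg_of_mul_nonneg_left h4 h5
        positivity
    rw [h0]; simpa using hn
  · have h4 : 0 < ‖y‖ ^ 2 := by positivity
    have h5 : (‖y‖ ^ 2) ^ 2 ≤ (∑ i ∈ F, ‖x i‖ ^ 2) * (D * ‖y‖ ^ 2) :=
      (pow_le_pow_left₀ (by positivity) h1 2).trans h3
    nlinarith

theorem exists_strongSum {V W : I → Submodule 𝕜 H} {ν ω : I → ℝ}
    (hV : IsBesselFusionSequence V ν) (hW : IsBesselFusionSequence W ω) (R : H →L[𝕜] H) :
    ∃ T : H →L[𝕜] H, ∀ f, HasSum (fun i =>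
      (((ω i * ν i : ℝ) : 𝕜) • (orthProj (V i) ∘L R ∘L orthProj (W i))) f) (T f) := by
  obtain ⟨-, D, hD0, hD⟩ := hV
  obtain ⟨-, E, hE0, hE⟩ := hW
  set A : I → H →L[𝕜] H := fun i =>
    ((ω i * ν i : ℝ) : 𝕜) • (orthProj (V i) ∘L R ∘L orthProj (W i)) with hA
  have hAi : ∀ i f, A i f = (ν i : 𝕜) • orthProj (V i) ((ω i : 𝕜) • R (orthProj (W i) f)) := by
    intro i f
    have h : A i f = ((ω i * ν i : ℝ) : 𝕜) • orthProj (V i) (R (orthProj (W i) f)) := rfl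
    rw [h, map_smul, smul_smul]
    congr 1
    push_cast
    ring
  have key : ∀ (f : H) (F : Finset I), ‖∑ i ∈ F, A i f‖ ^ 2 ≤
      D * ‖R‖ ^ 2 * ∑ i ∈ F, ω i ^ 2 * ‖orthProj (W i) f‖ ^ 2 := by
    intro f F
    simp only [hAi]
    refine (norm_finsum_sq_le hD F _).trans ?_
    rw [mul_assoc, Finset.mul_sum (a := ‖R‖ ^ 2)]
    refine mul_le_mul_of_nonneg_left (Finset.sum_le_sum fun i _ => ?_) hD0.le
    rw [norm_smul, mul_pow, RCLike.norm_ofReal, sq_abs]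
    have := pow_le_pow_left₀ (norm_nonneg _) (R.le_opNorm (orthProj (W i) f)) 2
    calc _ ≤ ω i ^ 2 * (‖R‖ * ‖orthProj (W i) f‖) ^ 2 := by gcongr
      _ = _ := by ring
  have hsum : ∀ f, Summable fun i => A i f := by
    intro f
    rw [summable_iff_vanishing_norm]
    intro ε hε
    have hs := (hE f).1.mul_left (D * ‖R‖ ^ 2)
    obtain ⟨s, hs⟩ := summable_iff_vanishing_norm.1 hs (ε ^ 2) (by positivity)
    refine ⟨s, fun t ht => ?_⟩
    have h1 := hs t ht
    rw [← Finset.mul_sum] at h1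
    exact lt_of_pow_lt_pow_left₀ 2 hε.le
      (((key f t).trans (le_abs_self _)).trans_lt h1)
  let L : H →ₗ[𝕜] H :=
    { toFun := fun f => ∑' i, A i f
      map_add' := fun f g => by
        simp only [map_add]; exact (hsum f).tsum_add (hsum g)
      map_smul' := fun c f => by
        simp only [map_smul, RingHom.id_apply]; exact (hsum f).tsum_const_smul c }
  have hL : ∀ f, HasSum (fun i => A i f) (L f) := fun f => (hsum f).hasSum
  have hbound : ∀ f, ‖L f‖ ≤ Real.sqrt (D * ‖R‖ ^ 2 * E) * ‖f‖ := by
    intro f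
    refine le_of_tendsto (hL f).norm (Filter.Eventually.of_forall fun F => ?_)
    refine le_of_sq_le_sq ?_ (by positivity)
    rw [mul_pow, Real.sq_sqrt (by positivity), mul_assoc]
    refine (key f F).trans (mul_le_mul_of_nonneg_left ?_ (by positivity))
    exact ((hE f).1.sum_le_tsum F fun i _ => by positivity).trans (hE f).2
  exact ⟨L.mkContinuous _ hbound, hL⟩

theorem hasSum_psi {V W : I → Submodule 𝕜 H} {ν ω : I → ℝ}
    (hV : IsBesselFusionSequence V ν) (hW : IsBesselFusionSequence W ω) (f : H) :
    HasSum (fun i => ((ω i * ν i : ℝ) : 𝕜) •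
      orthProj (V i) ((frameOp W ω).inverse (orthProj (W i) f))) (psi V ν W ω f) := by
  have h := exists_strongSum hV hW (frameOp W ω).inverse
  unfold psi strongSum
  rw [dif_pos h]
  exact h.choose_spec f

theorem hasSum_frameOp {W : I → Submodule 𝕜 H} {ω : I → ℝ}
    (hW : IsBesselFusionSequence W ω) (f : H) :
    HasSum (fun i => ((ω i ^ 2 : ℝ) : 𝕜) • orthProj (W i) f) (frameOp W ω f) := by
  have h : ∃ T : H →L[𝕜] H, ∀ f, HasSum (fun i =>
      (((ω i ^ 2 : ℝ) : 𝕜) • orthProj (W i)) f) (T f) := by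
    obtain ⟨T, hT⟩ := exists_strongSum hW hW (ContinuousLinearMap.id 𝕜 H)
    refine ⟨T, fun f => ?_⟩
    convert hT f using 2 with i
    simp [orthProj_idem, pow_two]
  unfold frameOp strongSum
  rw [dif_pos h]
  exact h.choose_spec f

theorem isInvertible_frameOp {W : I → Submodule 𝕜 H} {ω : I → ℝ} (hW : IsFusionFrame W ω) :
    (frameOp W ω).IsInvertible := by
  have hB := hW.isBessel
  obtain ⟨C, D, -, hC, -, hl, hu⟩ := hW
  have hunit : IsUnit (frameOp W ω) := by
    refine ContinuousLinearMap.isUnit_of_forall_le_norm_inner_map _ (c := ⟨C, hC.le⟩) hC fun f => ?_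
    have h1 : HasSum (fun i => ((ω i ^ 2 * ‖orthProj (W i) f‖ ^ 2 : ℝ) : 𝕜))
        ⟪f, frameOp W ω f⟫_𝕜 := by
      have h2 := (hasSum_frameOp hB f).mapL (innerSL 𝕜 f)
      simp only [innerSL_apply_apply] at h2
      convert h2 using 2 with i
      rw [inner_smul_right]
      rw [← orthProj_idem (W i) f, ← inner_orthProj, orthProj_idem, inner_self_eq_norm_sq_to_K]
      push_cast
      rfl
    have h3 := h1.unique ((RCLike.hasSum_ofReal 𝕜).2 (hu f).1.hasSum)
    rw [norm_inner_symm, h3, RCLike.norm_ofReal]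
    refine le_trans ?_ (le_abs_self _)
    rw [mul_comm]
    exact hl f
  obtain ⟨u, hu⟩ := hunit
  exact ⟨ContinuousLinearEquiv.ofUnit u, by ext x; rw [← hu]; rfl⟩

end FusionFrames

end

open scoped InnerProductSpace

namespace FusionFrames

variable {𝕜 : Type*} [RCLike 𝕜] {H : Type*} [NormedAddCommGroup H] [InnerProductSpace 𝕜 H] {I : Type*}

/-! Write `S` for the frame operator of `W` and `ψ` for `psi V ω W ω`. If `w ∈ W i`, then `w` has
two expansions along the Riesz sequence: the single term `w`, and `w = S (S⁻¹ w) = ∑ ω_j² π_{W_j}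
S⁻¹ w`. Uniqueness of components gives `π_{W_j} S⁻¹ w = 0` for `j ≠ i`. Hence only the `i`-th term
of `ψ (S⁻¹ w)` survives, it lies in `V i`, and so `S⁻¹ W_i ⊆ ψ⁻¹ V_i`
(`frameOp_inverse_mem_mapFamily`).

This inclusion is all that weaving needs beyond the Bessel property (`norm_sq_le_weaving`). Given
`σ`, split `f = f₁ + f₂` along the closed span of the `W_i`, `i ∈ σ`, and its orthogonal complement.
The expansion `f₁ = ∑ ω_i² π_{W_i} S⁻¹ f₁` lives on `σ`, while `f₂ = ∑ ω_i² S⁻¹ π_{W_i} f₂` lives on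
`σᶜ` with terms in `ψ⁻¹ V_i`. Cauchy–Schwarz then controls each part by the woven sum, with
constants independent of `σ`. -/

/-- The components of a convergent expansion along a fusion Riesz sequence are unique. -/
theorem IsFusionRieszSequence.eq_zero_of_hasSum {W : I → Submodule 𝕜 H}
    (hW : IsFusionRieszSequence W) {f : I → H} (hf : ∀ i, f i ∈ W i) (h : HasSum f 0) (i : I) :
    f i = 0 := by
  obtain ⟨-, C, D, hC, -, hCD⟩ := hW
  have h1 : C * ‖f i‖ ^ 2 ≤ ‖(0 : H)‖ ^ 2 := by
    refine ge_of_tendsto (h.norm.pow 2) ?_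
    filter_upwards [Filter.eventually_ge_atTop {i}] with J hJ
    refine le_trans ?_ (hCD J f fun j _ => hf j).1
    gcongr
    exact Finset.single_le_sum (f := fun j => ‖f j‖ ^ 2) (fun j _ => by positivity)
      (Finset.singleton_subset_iff.1 hJ)
  have h2 : ‖f i‖ ^ 2 ≤ 0 := by
    rw [norm_zero] at h1
    nlinarith
  exact norm_eq_zero.1 (pow_eq_zero_iff two_ne_zero |>.1 (le_antisymm h2 (by positivity)))

theorem isClosed_mapFamily {V : I → Submodule 𝕜 H} {T T' : H →L[𝕜] H}
    (h1 : ∀ x, T' (T x) = x) (h2 : ∀ x, T (T' x) = x) {i : I}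
    (hV : IsClosed (V i : Set H)) : IsClosed (mapFamily T V i : Set H) := by
  have h : (mapFamily T V i : Set H) = T' ⁻¹' (V i : Set H) := by
    ext x
    constructor
    · rintro ⟨v, hv, rfl⟩
      simpa [h1] using hv
    · intro hx
      exact ⟨T' x, hx, h2 x⟩
  rw [h]
  exact hV.preimage T'.continuous

/-- Cauchy–Schwarz in absorbed form: the weighted inequality `a b ≤ K a² / 2 + b² / (2 K)` is
summed, and the bound on the `b`-series makes its share at most `‖v‖² / 2`, which moves to the left.
-/
theorem norm_sq_le_of_hasSum_inner {v : H} {t : I → 𝕜} (ht : HasSum t ⟪v, v⟫_𝕜)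
    {ω a b : I → ℝ} {K : ℝ} (hK : 0 < K) (hle : ∀ i, ‖t i‖ ≤ ω i ^ 2 * (a i * b i))
    (ha : Summable fun i => ω i ^ 2 * a i ^ 2) (hb : Summable fun i => ω i ^ 2 * b i ^ 2)
    (hbK : ∑' i, ω i ^ 2 * b i ^ 2 ≤ K * ‖v‖ ^ 2) :
    ‖v‖ ^ 2 ≤ K * ∑' i, ω i ^ 2 * a i ^ 2 := by
  have h1 : ‖v‖ ^ 2 = ‖⟪v, v⟫_𝕜‖ := by
    rw [inner_self_eq_norm_sq_to_K]; simp
  have h2 : ∀ i, ‖t i‖ ≤ K / 2 * (ω i ^ 2 * a i ^ 2) + 1 / (2 * K) * (ω i ^ 2 * b i ^ 2) := by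
    intro i
    refine (hle i).trans ?_
    have h3 : K / 2 * (ω i ^ 2 * a i ^ 2) + 1 / (2 * K) * (ω i ^ 2 * b i ^ 2)
        - ω i ^ 2 * (a i * b i) = 1 / (2 * K) * (ω i * (K * a i - b i)) ^ 2 := by
      field_simp
      ring
    have h4 : 0 ≤ 1 / (2 * K) * (ω i * (K * a i - b i)) ^ 2 := by positivity
    linarith
  have h5 := (ha.hasSum.mul_left (K / 2)).add (hb.hasSum.mul_left (1 / (2 * K)))
  have h6 := tsum_of_norm_bounded h5 h2
  rw [ht.tsum_eq, ← h1] at h6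
  have h7 : 1 / (2 * K) * ∑' i, ω i ^ 2 * b i ^ 2 ≤ 1 / (2 * K) * (K * ‖v‖ ^ 2) := by gcongr
  have h8 : 1 / (2 * K) * (K * ‖v‖ ^ 2) = ‖v‖ ^ 2 / 2 := by field_simp
  linarith

variable [CompleteSpace H]

/-! ### Projections and the self-adjointness of the frame operator -/

theorem orthProj_mem {U : Submodule 𝕜 H} (hU : IsClosed (U : Set H)) (x : H) :
    orthProj U x ∈ U := by
  have h : orthProj U x ∈ U.topologicalClosure := Submodule.starProjection_apply_mem _ x
  rwa [hU.submodule_topologicalClosure_eq] at h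

theorem orthProj_eq_self {U : Submodule 𝕜 H} {x : H} (hx : x ∈ U) : orthProj U x = x :=
  Submodule.starProjection_eq_self_iff.2 (U.le_topologicalClosure hx)

theorem orthProj_eq_zero {U : Submodule 𝕜 H} (hU : IsClosed (U : Set H)) {x : H}
    (hx : ∀ u ∈ U, ⟪u, x⟫_𝕜 = 0) : orthProj U x = 0 := by
  have h := hx _ (orthProj_mem hU x)
  rwa [← orthProj_idem, inner_orthProj, inner_self_eq_zero] at h

theorem frameOp_inverse_apply {W : I → Submodule 𝕜 H} {ω : I → ℝ} (hW : IsFusionFrame W ω)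
    (x : H) : (frameOp W ω).inverse (frameOp W ω x) = x := by
  have h := (isInvertible_frameOp hW).inverse_comp_self
  exact DFunLike.congr_fun h x

theorem frameOp_apply_inverse {W : I → Submodule 𝕜 H} {ω : I → ℝ} (hW : IsFusionFrame W ω)
    (x : H) : frameOp W ω ((frameOp W ω).inverse x) = x := by
  have h := (isInvertible_frameOp hW).self_comp_inverse
  exact DFunLike.congr_fun h x

theorem inner_frameOp {W : I → Submodule 𝕜 H} {ω : I → ℝ}
    (hW : IsBesselFusionSequence W ω) (x y : H) :
    ⟪frameOp W ω x, y⟫_𝕜 = ⟪x, frameOp W ω y⟫_𝕜 := by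
  have h1 := (hasSum_frameOp hW y).mapL (innerSL 𝕜 x)
  have h2 := (RCLike.hasSum_conj' 𝕜).2 ((hasSum_frameOp hW x).mapL (innerSL 𝕜 y))
  simp only [innerSL_apply_apply, inner_conj_symm] at h1 h2
  refine h2.unique ?_
  convert h1 using 2 with i
  rw [inner_smul_left, inner_smul_right, inner_orthProj, RCLike.conj_ofReal]

theorem inner_frameOp_inverse {W : I → Submodule 𝕜 H} {ω : I → ℝ}
    (hW : IsFusionFrame W ω) (x y : H) :
    ⟪(frameOp W ω).inverse x, y⟫_𝕜 = ⟪x, (frameOp W ω).inverse y⟫_𝕜 := by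
  conv_lhs => rw [← frameOp_apply_inverse hW y]
  rw [← inner_frameOp hW.isBessel, frameOp_apply_inverse hW]

/-! ### Biorthogonality and its consequence for `ψ⁻¹ V_i` -/

/-- For a fusion Riesz basis, `S_W⁻¹ W_i` is orthogonal to `W_j` for `j ≠ i`. -/
theorem orthProj_frameOp_inverse_eq_zero {W : I → Submodule 𝕜 H} {ω : I → ℝ}
    (hR : IsFusionRieszSequence W) (hW : IsFusionFrame W ω) {i j : I} (hij : j ≠ i) {w : H}
    (hw : w ∈ W i) : orthProj (W j) ((frameOp W ω).inverse w) = 0 := by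
  classical
  have h1 := hasSum_frameOp hW.isBessel ((frameOp W ω).inverse w)
  rw [frameOp_apply_inverse hW] at h1
  -- Subtracting the one-term expansion of `w` leaves an expansion of `0`, whose `j`-th component is
  -- `ω_j² π_{W_j} S⁻¹ w`.
  have h2 := h1.sub (hasSum_ite_eq i w)
  rw [sub_self] at h2
  have h3 := hR.eq_zero_of_hasSum (fun k => ?_) h2 j
  · have hpos := hW.isBessel.1.pos j
    simpa [hij, hpos.ne'] using h3
  · refine (W k).sub_mem ((W k).smul_mem _ (orthProj_mem (hR.1 k) _)) ?_
    split_ifs with hk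
    · exact hk ▸ hw
    · exact (W k).zero_mem

/-- For a fusion Riesz basis `W`, the image of `V_i` under `ψ_{vw}⁻¹` contains `S_W⁻¹ W_i`. -/
theorem frameOp_inverse_mem_mapFamily {V W : I → Submodule 𝕜 H} {ω ν : I → ℝ}
    (hR : IsFusionRieszSequence W) (hW : IsFusionFrame W ω) (hV : IsBesselFusionSequence V ν)
    (hψ : (psi V ν W ω).IsInvertible) {i : I} {w : H} (hw : w ∈ W i) :
    (frameOp W ω).inverse w ∈ mapFamily (psi V ν W ω).inverse V i := by
  have h1 := hasSum_psi hV hW.isBessel ((frameOp W ω).inverse w)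
  have h2 := h1.unique (hasSum_single i fun j hj => by
    rw [orthProj_frameOp_inverse_eq_zero hR hW hj hw]; simp)
  refine ⟨psi V ν W ω ((frameOp W ω).inverse w), ?_, ?_⟩
  · rw [h2]
    exact (V i).smul_mem _ (orthProj_mem (hV.1.isClosed i) _)
  · exact DFunLike.congr_fun hψ.inverse_comp_self _

/-! ### Images of Bessel sequences -/

/-- Writing the projection as `u = T v` with `v ∈ V i`, one has `‖u‖² = ⟪f, T v⟫ = ⟪π_{V_i} T* f,
v⟫` and `‖v‖ ≤ ‖T'‖ ‖u‖`. -/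
theorem norm_orthProj_mapFamily_le {V : I → Submodule 𝕜 H} {T T' : H →L[𝕜] H}
    (h1 : ∀ x, T' (T x) = x) (h2 : ∀ x, T (T' x) = x) {i : I}
    (hV : IsClosed (V i : Set H)) (f : H) :
    ‖orthProj (mapFamily T V i) f‖ ≤ ‖T'‖ * ‖orthProj (V i) (T.adjoint f)‖ := by
  set U := mapFamily T V i
  set u := orthProj U f with hu
  obtain ⟨v, hv, hvu⟩ : u ∈ U := orthProj_mem (isClosed_mapFamily h1 h2 hV) f
  have hvu' : T v = u := hvu
  have h3 : ⟪u, u⟫_𝕜 = ⟪orthProj (V i) (T.adjoint f), v⟫_𝕜 := by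
    rw [inner_orthProj (V i), orthProj_eq_self hv, ContinuousLinearMap.adjoint_inner_left, hvu']
    nth_rw 1 [hu]
    rw [inner_orthProj, hu, orthProj_idem]
  have h4 : ‖u‖ ^ 2 = ‖⟪u, u⟫_𝕜‖ := by
    rw [inner_self_eq_norm_sq_to_K]; simp
  have h5 : ‖v‖ ≤ ‖T'‖ * ‖u‖ := by
    have := T'.le_opNorm u
    rwa [← hvu', h1, hvu'] at this
  have h6 : ‖u‖ ^ 2 ≤ ‖orthProj (V i) (T.adjoint f)‖ * (‖T'‖ * ‖u‖) := by
    rw [h4, h3]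
    exact (norm_inner_le_norm _ _).trans (by gcongr)
  rcases (norm_nonneg u).eq_or_lt with h0 | h0
  · rw [← h0]; positivity
  · nlinarith

/-- The image of a Bessel fusion sequence under an invertible operator is a Bessel fusion
sequence. -/
theorem IsBesselFusionSequence.mapFamily {V : I → Submodule 𝕜 H} {ν : I → ℝ}
    (hV : IsBesselFusionSequence V ν) {T T' : H →L[𝕜] H}
    (h1 : ∀ x, T' (T x) = x) (h2 : ∀ x, T (T' x) = x) :
    IsBesselFusionSequence (mapFamily T V) ν := by
  obtain ⟨⟨hc, hp⟩, D, hD0, hD⟩ := hV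
  have hle : ∀ f i, ν i ^ 2 * ‖orthProj (FusionFrames.mapFamily T V i) f‖ ^ 2 ≤
      ‖T'‖ ^ 2 * (ν i ^ 2 * ‖orthProj (V i) (T.adjoint f)‖ ^ 2) := fun f i => by
    have := pow_le_pow_left₀ (norm_nonneg _) (norm_orthProj_mapFamily_le h1 h2 (hc i) f) 2
    calc _ ≤ ν i ^ 2 * (‖T'‖ * ‖orthProj (V i) (T.adjoint f)‖) ^ 2 := by gcongr
      _ = _ := by ring
  -- The `+ 1` keeps the bound positive even when the operators vanish, as on the zero space.
  refine ⟨⟨fun i => isClosed_mapFamily h1 h2 (hc i), hp⟩,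
    ‖T'‖ ^ 2 * (D * ‖T.adjoint‖ ^ 2) + 1, by positivity, fun f => ?_⟩
  have hs := (hD (T.adjoint f)).1.mul_left (‖T'‖ ^ 2)
  have hs' := Summable.of_nonneg_of_le (fun i => by positivity) (hle f) hs
  refine ⟨hs', (hs'.tsum_le_tsum (hle f) hs).trans ?_⟩
  rw [tsum_mul_left]
  have h3 := pow_le_pow_left₀ (norm_nonneg _) (T.adjoint.le_opNorm f) 2
  calc _ ≤ ‖T'‖ ^ 2 * (D * (‖T.adjoint‖ * ‖f‖) ^ 2) := by
        gcongr
        exact (hD _).2.trans (by gcongr)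
    _ ≤ ‖T'‖ ^ 2 * (D * (‖T.adjoint‖ * ‖f‖) ^ 2) + ‖f‖ ^ 2 := by
        linarith [sq_nonneg ‖f‖]
    _ = _ := by ring

/-! ### Weavings -/

/-- The lower bound for the weavings of a fusion Riesz basis `W` with a family `U` satisfying
`S_W⁻¹ W_i ⊆ U_i`. -/
theorem norm_sq_le_weaving {W U X : I → Submodule 𝕜 H} {ω : I → ℝ}
    (hR : IsFusionRieszSequence W) (hW : IsFusionFrame W ω)
    (hU : ∀ i, ∀ w ∈ W i, (frameOp W ω).inverse w ∈ U i)
    {D : ℝ} (hD0 : 0 < D) (hD : HasUpperBound W ω D)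
    (σ : Set I) (hXW : ∀ i ∈ σ, X i = W i) (hXU : ∀ i ∉ σ, X i = U i) (f : H)
    (hs : Summable fun i => ω i ^ 2 * ‖orthProj (X i) f‖ ^ 2) :
    ‖f‖ ^ 2 ≤ 2 * (D * ‖(frameOp W ω).inverse‖ ^ 2 + 1) *
      ∑' i, ω i ^ 2 * ‖orthProj (X i) f‖ ^ 2 := by
  set R := (frameOp W ω).inverse with hRdef
  set K := D * ‖R‖ ^ 2 + 1
  have hK : 0 < K := by positivity
  set M := (⨆ i ∈ σ, W i).topologicalClosure
  have hWM : ∀ i ∈ σ, W i ≤ M := fun i hi =>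
    (le_iSup₂_of_le (f := fun j (_ : j ∈ σ) => W j) i hi le_rfl).trans (Submodule.le_topologicalClosure _)
  set f₁ := M.starProjection f
  have hf₁M : f₁ ∈ M := Submodule.starProjection_apply_mem _ _
  set f₂ := f - f₁ with hf₂
  have hf₂M : f₂ ∈ Mᗮ := Submodule.sub_starProjection_mem_orthogonal _
  -- The vanishing on each `W j`, `j ∈ σ`, passes to the closed span because a kernel is closed.
  have hout : ∀ i ∉ σ, orthProj (W i) (R f₁) = 0 := by
    intro i hi
    have hker : M ≤ LinearMap.ker ((orthProj (W i) ∘L R : H →L[𝕜] H) : H →ₗ[𝕜] H) := by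
      refine Submodule.topologicalClosure_minimal _ (iSup₂_le fun j hj w hw => ?_)
        (ContinuousLinearMap.isClosed_ker _)
      exact orthProj_frameOp_inverse_eq_zero (i := j) (j := i) hR hW
        (by rintro rfl; exact hi hj) hw
    exact hker hf₁M
  have hin : ∀ i ∈ σ, orthProj (W i) f₂ = 0 := fun i hi =>
    orthProj_eq_zero (hR.1 i) fun u hu => hf₂M u (hWM i hi hu)
  have h₁ : ‖f₁‖ ^ 2 ≤ K * ∑' i, ω i ^ 2 * ‖orthProj (X i) f‖ ^ 2 := by
    have hsum := (hasSum_frameOp hW.isBessel (R f₁)).mapL (innerSL 𝕜 f₁)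
    rw [frameOp_apply_inverse hW] at hsum
    simp only [innerSL_apply_apply] at hsum
    refine norm_sq_le_of_hasSum_inner hsum (b := fun i => ‖orthProj (W i) (R f₁)‖) hK
      (fun i => ?_) hs (hD _).1 ((hD _).2.trans ?_)
    · by_cases hi : i ∈ σ
      · have h3 : orthProj (W i) f₁ = orthProj (W i) f := by
          have := hin i hi
          rw [hf₂, map_sub, sub_eq_zero] at this
          exact this.symm
        have h4 : ⟪f₁, orthProj (W i) (R f₁)⟫_𝕜 =
            ⟪orthProj (W i) f, orthProj (W i) (R f₁)⟫_𝕜 := by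
          rw [← h3, inner_orthProj, orthProj_idem]
        rw [inner_smul_right, h4, norm_mul,
          RCLike.norm_ofReal, abs_of_nonneg (sq_nonneg _), hXW i hi]
        gcongr
        exact norm_inner_le_norm _ _
      · simp [hout i hi]
    · have h3 := pow_le_pow_left₀ (norm_nonneg _) (R.le_opNorm f₁) 2
      calc D * ‖R f₁‖ ^ 2 ≤ D * (‖R‖ * ‖f₁‖) ^ 2 := by gcongr
        _ ≤ D * (‖R‖ * ‖f₁‖) ^ 2 + ‖f₁‖ ^ 2 := by linarith [sq_nonneg ‖f₁‖]
        _ = K * ‖f₁‖ ^ 2 := by ring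
  have h₂ : ‖f₂‖ ^ 2 ≤ K * ∑' i, ω i ^ 2 * ‖orthProj (X i) f‖ ^ 2 := by
    -- Here `R` is applied after the projections, so that the terms lie in `U i`.
    have hsum := ((hasSum_frameOp hW.isBessel f₂).mapL R).mapL (innerSL 𝕜 f₂)
    rw [frameOp_inverse_apply hW] at hsum
    simp only [innerSL_apply_apply] at hsum
    have hb : ∀ i, ω i ^ 2 * (‖R‖ * ‖orthProj (W i) f₂‖) ^ 2 =
        ‖R‖ ^ 2 * (ω i ^ 2 * ‖orthProj (W i) f₂‖ ^ 2) := fun i => by ring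
    refine norm_sq_le_of_hasSum_inner hsum (b := fun i => ‖R‖ * ‖orthProj (W i) f₂‖) hK
      (fun i => ?_) hs ?_ ?_
    · by_cases hi : i ∈ σ
      · simp [hin i hi]
      -- Off `σ` the term is orthogonal to `f₁`, so `f₂` may be replaced by `f` and then by its
      -- projection onto `U i`.
      · have h3 : ⟪f₁, R (orthProj (W i) f₂)⟫_𝕜 = 0 := by
          rw [← inner_frameOp_inverse hW, ← inner_orthProj, ← hRdef, hout i hi, inner_zero_left]
        have h4 : ⟪f₂, R (orthProj (W i) f₂)⟫_𝕜 =
            ⟪orthProj (U i) f, R (orthProj (W i) f₂)⟫_𝕜 := by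
          rw [inner_orthProj, orthProj_eq_self (hU i _ (orthProj_mem (hR.1 i) _)),
            show f₂ = f - f₁ from rfl, inner_sub_left, ← hf₂, h3, sub_zero]
        rw [map_smul, inner_smul_right, h4, norm_mul,
          RCLike.norm_ofReal, abs_of_nonneg (sq_nonneg _), hXU i hi]
        gcongr
        exact (norm_inner_le_norm _ _).trans (by gcongr; exact R.le_opNorm _)
    · simp only [hb]
      exact (hD f₂).1.mul_left _
    · simp only [hb]
      rw [tsum_mul_left]
      calc _ ≤ ‖R‖ ^ 2 * (D * ‖f₂‖ ^ 2) := by gcongr; exact (hD f₂).2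
        _ ≤ ‖R‖ ^ 2 * (D * ‖f₂‖ ^ 2) + ‖f₂‖ ^ 2 := by linarith [sq_nonneg ‖f₂‖]
        _ = K * ‖f₂‖ ^ 2 := by ring
  have h₃ : ‖f‖ ^ 2 = ‖f₁‖ ^ 2 + ‖f₂‖ ^ 2 := by
    have h4 := norm_add_sq_eq_norm_sq_add_norm_sq_of_inner_eq_zero f₁ f₂ (hf₂M f₁ hf₁M)
    rw [hf₂, add_sub_cancel, ← hf₂] at h4
    simpa only [pow_two] using h4
  linarith

/-- A fusion Riesz basis `W` and a Bessel fusion sequence `U` with `S_W⁻¹ W_i ⊆ U_i` are woven. -/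
theorem isWoven_of_frameOp_inverse_mem {W U : I → Submodule 𝕜 H} {ω : I → ℝ}
    (hR : IsFusionRieszSequence W) (hW : IsFusionFrame W ω) (hUB : IsBesselFusionSequence U ω)
    (hU : ∀ i, ∀ w ∈ W i, (frameOp W ω).inverse w ∈ U i) :
    IsWoven ![W, U] ![ω, ω] := by
  obtain ⟨⟨hWc, hω⟩, D, hD0, hD⟩ := hW.isBessel
  obtain ⟨⟨hUc, -⟩, E, hE0, hE⟩ := hUB
  set K := 2 * (D * ‖(frameOp W ω).inverse‖ ^ 2 + 1)
  have hK : 0 < K := by positivity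
  -- The lower bound is `K⁻¹`; the minimum only secures that it does not exceed the upper bound.
  have key : ∀ p : I → Fin 2, IsFusionFrameWith (fun i => (![W, U] : Fin 2 → _) (p i) i)
      (fun i => (![ω, ω] : Fin 2 → _) (p i) i) (min K⁻¹ (D + E)) (D + E) := by
    intro p
    have hωp : (fun i => (![ω, ω] : Fin 2 → _) (p i) i) = ω := by
      funext i
      generalize p i = j
      fin_cases j <;> rfl
    rw [hωp]
    set X : I → Submodule 𝕜 H := fun i => (![W, U] : Fin 2 → _) (p i) i with hX
    have hXW : ∀ i ∈ {i | p i = 0}, X i = W i := fun i hi => by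
      have hi : p i = 0 := hi
      simp [hX, hi]
    have hXU : ∀ i ∉ {i | p i = 0}, X i = U i := fun i hi => by
      have hi : p i = 1 := Fin.eq_one_of_ne_zero _ hi
      simp [hX, hi]
    have hor : ∀ i, X i = W i ∨ X i = U i := fun i => by
      by_cases hi : i ∈ {i | p i = 0}
      · exact .inl (hXW i hi)
      · exact .inr (hXU i hi)
    have hup : HasUpperBound X ω (D + E) := by
      intro f
      have hle : ∀ i, ω i ^ 2 * ‖orthProj (X i) f‖ ^ 2 ≤
          ω i ^ 2 * ‖orthProj (W i) f‖ ^ 2 + ω i ^ 2 * ‖orthProj (U i) f‖ ^ 2 := fun i => by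
        rcases hor i with h | h <;> rw [h]
        · exact le_add_of_nonneg_right (by positivity)
        · exact le_add_of_nonneg_left (by positivity)
      have hs := (hD f).1.add (hE f).1
      have hs' := Summable.of_nonneg_of_le (fun i => by positivity) hle hs
      refine ⟨hs', (hs'.tsum_le_tsum hle hs).trans ?_⟩
      rw [(hD f).1.tsum_add (hE f).1, add_mul]
      exact add_le_add (hD f).2 (hE f).2
    refine ⟨⟨fun i => ?_, hω⟩, lt_min (by positivity) (by positivity), min_le_right _ _,
      fun f => ?_, hup⟩
    · rcases hor i with h | h <;> rw [h]
      exacts [hWc i, hUc i]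
    · have h1 := norm_sq_le_weaving hR hW hU hD0 hD {i | p i = 0} hXW hXU f (hup f).1
      calc min K⁻¹ (D + E) * ‖f‖ ^ 2 ≤ K⁻¹ * ‖f‖ ^ 2 := by gcongr; exact min_le_left _ _
        _ ≤ _ := by rwa [inv_mul_le_iff₀ hK]
  -- Constant partitions show that `W` and `U` are themselves fusion frames.
  exact ⟨fun j => ⟨_, _, key fun _ => j⟩, _, _, key⟩

theorem IsApproximateDual.isInvertible_psi {V W : I → Submodule 𝕜 H} {ν ω : I → ℝ}
    (h : IsApproximateDual V ν W ω) : (psi V ν W ω).IsInvertible := by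
  have hu : IsUnit (psi V ν W ω) := by
    have := isUnit_one_sub_of_norm_lt_one (x := 1 - psi V ν W ω) h.2.2
    rwa [sub_sub_cancel] at this
  obtain ⟨u, hu⟩ := hu
  exact ⟨ContinuousLinearEquiv.ofUnit u, by ext x; rw [← hu]; rfl⟩

end FusionFrames

theorem mainTheorem10 {𝕜 : Type*} [RCLike 𝕜] {H : Type*} [NormedAddCommGroup H]
    [InnerProductSpace 𝕜 H] [CompleteSpace H] [TopologicalSpace.SeparableSpace H]
    {I : Type*} [Countable I] (W V : I → Submodule 𝕜 H) (ω : I → ℝ)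
    (hRiesz : FusionFrames.IsFusionRieszBasis W)
    (hdual : FusionFrames.IsApproximateDual V ω W ω) :
    (FusionFrames.psi V ω W ω).IsInvertible ∧
      FusionFrames.IsWoven
        ![W, FusionFrames.mapFamily (FusionFrames.psi V ω W ω).inverse V] ![ω, ω] := by
  have hψ := hdual.isInvertible_psi
  refine ⟨hψ, FusionFrames.isWoven_of_frameOp_inverse_mem hRiesz.1 hdual.1 ?_ ?_⟩
  · exact hdual.2.1.mapFamily (fun x => DFunLike.congr_fun hψ.self_comp_inverse x)
      fun x => DFunLike.congr_fun hψ.inverse_comp_self x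
  · exact fun i w hw =>
      FusionFrames.frameOp_inverse_mem_mapFamily hRiesz.1 hdual.1 hdual.2.1 hψ hw
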